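/- Let $r$ be a prime power, $d$ a positive integer, $q=r^d$, and let $\mathbb F_q[x;r]$ be the set of $r$-additive polynomials $\sum_{0\le j\le n} a_j x^{r^j}$ over $\mathbb F_q$. A decomposition of $f$ in $\mathbb F_q[x;r]$ is a pair $(g,h)$ of monic polynomials in $\mathbb F_q[x;r]$ of degree at least $2$ with $f=g\circ h$. An $i$-collision of $f$ is a set of $i$ decompositions $(g,h)$ of $f$ with $\deg g$ the same for all of them; it is maximal if it is not contained in an $(i+1)$-collision of $f$. For $a,b\in\mathbb F_q$ let $\Psi_2^{(a,b)}=x^{r+1}+ax+b$, and for each integer $i\ge 0$ let $$C_i^{(2)}=\{(a,b)\in\mathbb F_q^2 : ab\neq 0,\ \Psi_2^{(a,b)}\text{ has exactly } i \text{ distinct roots in } \mathbb F_q\},\qquad c_i^{(2)}=\# C_i^{(2)}.$$ Then for every $i\ge 0$ $$C_i^{(2)}=\{(a,b)\in(\mathbb F_q^\times)^2 : x^{r^2}+ax^r+bx \text{ has a maximal } i\text{-collision in } \mathbb F_q[x;r]\},$$ $C_i^{(2)}=\emptyset$ for $i\notin\{0,1,2,r+1\}$, and the following holds. (i) If $d$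 is even, then $[c_0^{(2)},c_1^{(2)},c_2^{(2)},c_{r+1}^{(2)}]$ equals $$\left[\frac{r(q-1)^2}{2(r+1)},\ \frac{q(q-1)}{r},\ \frac{(q-1)^2(r-2)}{2(r-1)},\ \frac{(q-1)(q-r^2)}{r(r^2-1)}\right].$$ (ii) If $r$ is odd and $d$ is odd, then $[c_0^{(2)},c_1^{(2)},c_2^{(2)},c_{r+1}^{(2)}]$ equals $$\left[\frac{(qr-1)(q-1)}{2(r+1)},\ \frac{q(q-1)}{r},\ \frac{(q-1)(qr-2q-2r+3)}{2(r-1)},\ \frac{(q-r)(q-1)}{r(r^2-1)}\right].$$ (iii) If $r$ is even and $d$ is odd, then $[c_0^{(2)},c_1^{(2)},c_2^{(2)},c_{r+1}^{(2)}]$ equals $$\left[\frac{r(q^2-1)}{2(r+1)},\ \frac{(q-1)(q-r)}{r},\ \frac{(q-1)^2(r-2)}{2(r-1)},\ \frac{(q-r)(q-1)}{r(r^2-1)}\right].$$ Moreover, for every $i\ge 0$, $c_i^{(2)}$ is $q-1$ times the number (studied by Bluher) of $u\in\mathbb F_q^\times$ for which $x^{r+1}-ux+u$ has exactly $i$ distinct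 roots in $\mathbb F_q$. -/

import Mathlib

open Polynomial

namespace ProjPoly

/-- `f` is an `r`-additive polynomial, `f = ∑_{i ≤ n} a_i x^{r^i}`, i.e. `f ∈ F[x; r]`. -/
def IsAdditive {F : Type*} [Field F] (r : ℕ) (f : F[X]) : Prop :=
  ∃ (n : ℕ) (a : ℕ → F), f = ∑ i ∈ Finset.range (n + 1), C (a i) * X ^ (r ^ i)

/-- `(g, h)` is a decomposition of `f` in `F[x; r]`: both components are monic `r`-additive
(hence have constant term `0`) of degree at least `2`, and `f = g ∘ h`. -/
def IsDecomposition {F : Type*} [Field F] (r : ℕ) (f g h : F[X]) : Prop :=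
  IsAdditive r g ∧ IsAdditive r h ∧ g.Monic ∧ h.Monic ∧
    2 ≤ g.natDegree ∧ 2 ≤ h.natDegree ∧ f = g.comp h

/-- `S` is an (equal-degree) `i`-collision of `f` in `F[x; r]`: a set of `i` pairs `(g, h)`,
all with the same composition `f`, and with `deg g` the same for all pairs. -/
def IsCollision {F : Type*} [Field F] (r : ℕ) (f : F[X]) (i : ℕ)
    (S : Finset (F[X] × F[X])) : Prop :=
  S.card = i ∧ (∀ P ∈ S, IsDecomposition r f P.1 P.2) ∧
    ∃ n : ℕ, ∀ P ∈ S, P.1.natDegree = n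

/-- `f` has a maximal `i`-collision in `F[x; r]`: an `i`-collision of `f` that is not contained
in an `(i+1)`-collision of `f`. -/
def HasMaximalCollision {F : Type*} [Field F] (r : ℕ) (f : F[X]) (i : ℕ) : Prop :=
  ∃ S : Finset (F[X] × F[X]), IsCollision r f i S ∧
    ¬ ∃ T : Finset (F[X] × F[X]), IsCollision r f (i + 1) T ∧ S ⊆ T

/-- The projective polynomial `Ψ_m^{(a,b)} = x^{(r^m - 1)/(r - 1)} + a x + b`. -/
noncomputable def Psi {F : Type*} [Field F] (r m : ℕ) (a b : F) : F[X] :=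
  X ^ ((r ^ m - 1) / (r - 1)) + C a * X + C b

/-- The number of (distinct) roots of `f` in `F`. -/
noncomputable def numRoots {F : Type*} [Field F] (f : F[X]) : ℕ :=
  {x : F | f.IsRoot x}.ncard

/-- `C^{(2)}_{q,r,m,i}`: the pairs `(a, b)` with `ab ≠ 0` such that `Ψ_m^{(a,b)}` has exactly
`i` roots in `F`, a field with `q` elements. -/
def C2 (F : Type*) [Field F] (r m i : ℕ) : Set (F × F) :=
  {p | numRoots (Psi r m p.1 p.2) = i ∧ p.1 * p.2 ≠ 0}

/-- `c^{(2)}_{q,r,m,i} = # C^{(2)}_{q,r,m,i}`. -/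
noncomputable def c2 (F : Type*) [Field F] (r m i : ℕ) : ℕ := (C2 F r m i).ncard

/-- The one-parameter count: the number of `u ∈ Fˣ` for which `x^{r+1} - u x + u` has exactly
`i` roots in `F`. -/
noncomputable def bluherCount (F : Type*) [Field F] (r i : ℕ) : ℕ :=
  {u : F | u ≠ 0 ∧ numRoots (X ^ (r + 1) - C u * X + C u : F[X]) = i}.ncard

end ProjPoly

namespace ProjPoly

/-! ### Fibres and images of `x ^ r`, `x ^ (r - 1)` and `t ^ r - t` on a finite field. -/

section FrobeniusCounts

variable {F : Type*} [Field F] {r : ℕ}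

/-! A decomposition of x^(r^2) + a x^r + b x is forced to be (x^r + g x, x^r + h x) with h^r + g = a
and g h = b, so -h is a root of x^(r+1) + a x + b. All decompositions share the left degree r, hence
only the full set of them is a maximal collision (`hasMaximalCollision_iff`). Scaling x by c = -b/a
reduces the pairs (a, b) to q - 1 copies of the family x^(r+1) - u x + u (`c2_eq_mul_bluherCount`).

That family is counted through its roots (`mul_bluherCount`): a root y + 1 determines u =
(y+1)^(r+1)/y, and the other roots correspond to solutions of s^r = y (s + 1). If y is not an
(r-1)-th power of a unit, there is exactly one. If y = w^(r-1), putting s = t w gives t^r - t = 1/w,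
with 0 or r solutions. So the total is 2, 1 or r + 1, and counting y of each type is counting w.

The value y = -1 must be excluded. This costs v, the number of solutions of x^r = -x, and e, the
number of those of the form t^r - t. Only these two depend on the parities of r and d;
`bluherCount_formula` expresses every count through them, the rootless case being the complement. -/

lemma neg_pow_of_pow_add (hr : 2 ≤ r) (hadd : ∀ x y : F, (x + y) ^ r = x ^ r + y ^ r) (x : F) :
    (-x) ^ r = -x ^ r := by
  have h := hadd x (-x)
  rw [add_neg_cancel, zero_pow (by omega)] at h
  linear_combination -h

lemma sub_pow_of_pow_add (hr : 2 ≤ r) (hadd : ∀ x y : F, (x + y) ^ r = x ^ r + y ^ r) (x y : F) :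
    (x - y) ^ r = x ^ r - y ^ r := by
  rw [sub_eq_add_neg, hadd, neg_pow_of_pow_add hr hadd, sub_eq_add_neg]

lemma ncard_ne_zero_add_one [Finite F] {s : Set F} (h : (0 : F) ∈ s) :
    {x | x ≠ 0 ∧ x ∈ s}.ncard + 1 = s.ncard := by
  rw [← Set.ncard_sdiff_singleton_add_one h (Set.toFinite s)]
  congr 2
  ext x; simp [and_comm]

/-- The unit group is cyclic, so the kernel of its n-th power map has order gcd(q - 1, n). -/
lemma ncard_pow_eq_one [Finite F] {n : ℕ} (hn : 0 < n) (h : n ∣ Nat.card F - 1) :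
    {x : F | x ^ n = 1}.ncard = n := by
  have h1 := IsCyclic.card_powMonoidHom_ker (G := Fˣ) n
  rw [Nat.card_units, Nat.gcd_eq_right h] at h1
  refine Eq.trans ?_ h1
  rw [← Nat.card_coe_set_eq]
  symm
  refine Nat.card_congr (Equiv.ofBijective
    (fun x : (powMonoidHom n : Fˣ →* Fˣ).ker => (⟨((x : Fˣ) : F), ?_⟩ : {x : F | x ^ n = 1}))
    ⟨?_, ?_⟩)
  · have := x.2
    rw [MonoidHom.mem_ker, powMonoidHom_apply] at this
    have := congrArg (Units.val) this
    simpa using this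
  · intro x y hxy
    exact Subtype.ext (Units.ext (congrArg Subtype.val hxy))
  · rintro ⟨x, hx⟩
    have hx' : x ^ n = 1 := hx
    have hx0 : x ≠ 0 := by
      rintro rfl
      rw [zero_pow hn.ne'] at hx'
      exact zero_ne_one hx'
    exact ⟨⟨Units.mk0 x hx0, by simp [MonoidHom.mem_ker, Units.ext_iff, hx']⟩, rfl⟩

lemma pow_eq_self_iff {x : F} (hx : x ≠ 0) {n : ℕ} (hn : 0 < n) :
    x ^ n = x ↔ x ^ (n - 1) = 1 := by
  obtain ⟨m, rfl⟩ : ∃ m, n = m + 1 := ⟨n - 1, by omega⟩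
  rw [Nat.add_sub_cancel, pow_succ]
  constructor
  · intro h; exact mul_right_cancel₀ hx (by rw [h, one_mul])
  · intro h; rw [h, one_mul]

lemma ncard_pow_eq_self [Finite F] {d e : ℕ} (hr : 2 ≤ r) (hF : Nat.card F = r ^ d) (he : 0 < e)
    (hed : e ∣ d) : {x : F | x ^ r ^ e = x}.ncard = r ^ e := by
  have h2 : 2 ≤ r ^ e := hr.trans (Nat.le_self_pow he.ne' r)
  rw [← ncard_ne_zero_add_one (by simp [show r ≠ 0 by omega])]
  have : {x : F | x ≠ 0 ∧ x ∈ {x : F | x ^ r ^ e = x}} = {x : F | x ^ (r ^ e - 1) = 1} := by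
    ext x
    constructor
    · rintro ⟨h0, h⟩
      exact (pow_eq_self_iff h0 (by omega)).1 h
    · intro h
      have h0 : x ≠ 0 := by
        rintro rfl
        rw [Set.mem_ofPred_eq, zero_pow (by omega)] at h
        exact zero_ne_one h
      exact ⟨h0, (pow_eq_self_iff h0 (by omega)).2 h⟩
  rw [this, ncard_pow_eq_one (by omega)]
  · omega
  · rw [hF]
    obtain ⟨k, rfl⟩ := hed
    rw [pow_mul]
    exact Nat.sub_one_dvd_pow_sub_one _ _

lemma ncard_pow_eq [Finite F] {d : ℕ} (hr : 2 ≤ r) (hF : Nat.card F = r ^ d) :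
    {x : F | x ^ r = x}.ncard = r := by
  simpa using ncard_pow_eq_self hr hF one_pos (one_dvd d)

lemma ncard_pow_sub_one_eq [Finite F] {d : ℕ} (hr : 2 ≤ r) (hF : Nat.card F = r ^ d)
    {w : F} (hw : w ≠ 0) : {v : F | v ^ (r - 1) = w ^ (r - 1)}.ncard = r - 1 := by
  have h1 : {v : F | v ^ (r - 1) = w ^ (r - 1)} = (fun x => w * x) '' {x : F | x ^ (r - 1) = 1} := by
    ext v
    simp only [Set.mem_ofPred_eq, Set.mem_image]
    constructor
    · intro h
      refine ⟨v / w, ?_, by field_simp⟩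
      rw [div_pow, h, div_self (pow_ne_zero _ hw)]
    · rintro ⟨x, hx, rfl⟩
      rw [mul_pow, hx, mul_one]
  rw [h1, Set.ncard_image_of_injective _ (mul_right_injective₀ hw), ncard_pow_eq_one (by omega)]
  rw [hF]
  exact Nat.sub_one_dvd_pow_sub_one _ _

/-- The map w ↦ w^(r-1) is (r-1)-to-one on units, so a property of y = w^(r-1) may be counted on w
instead. -/
lemma ncard_pow_preimage [Finite F] {d : ℕ} (hr : 2 ≤ r) (hF : Nat.card F = r ^ d)
    (P : F → Prop) :
    {w : F | w ≠ 0 ∧ P (w ^ (r - 1))}.ncard =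
      (r - 1) * {y : F | (∃ w : F, w ≠ 0 ∧ y = w ^ (r - 1)) ∧ P y}.ncard := by
  classical
  have := Fintype.ofFinite F
  rw [Set.ncard_eq_toFinset_card', Set.ncard_eq_toFinset_card',
    Finset.card_eq_sum_card_fiberwise (f := fun w : F => w ^ (r - 1))
      (t := {y : F | (∃ w : F, w ≠ 0 ∧ y = w ^ (r - 1)) ∧ P y}.toFinset)]
  · rw [Finset.sum_const_nat (m := r - 1), mul_comm]
    intro y hy
    simp only [Set.toFinset_ofPred, Finset.mem_filter, Finset.mem_univ, true_and] at hy
    obtain ⟨⟨w, hw, rfl⟩, hP⟩ := hy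
    refine Eq.trans ?_ (ncard_pow_sub_one_eq hr hF hw)
    rw [Set.ncard_eq_toFinset_card']
    congr 1
    ext v
    simp only [Set.toFinset_ofPred, Finset.mem_filter, Finset.mem_univ, true_and]
    constructor
    · exact fun h => h.2
    · intro h
      refine ⟨⟨?_, h ▸ hP⟩, h⟩
      rintro rfl
      by_cases h1 : r - 1 = 0
      · omega
      · rw [zero_pow h1] at h
        exact pow_ne_zero _ hw h.symm
  · intro w hw
    simp only [Set.toFinset_ofPred, Finset.coe_filter, Finset.mem_univ, true_and,
      Set.mem_ofPred_eq] at hw ⊢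
    exact ⟨⟨w, hw.1, rfl⟩, hw.2⟩

lemma powSubSelf_eq_iff (hr : 2 ≤ r) (hadd : ∀ x y : F, (x + y) ^ r = x ^ r + y ^ r) (s t : F) :
    t ^ r - t = s ^ r - s ↔ (t - s) ^ r = t - s := by
  rw [sub_pow_of_pow_add hr hadd]
  constructor <;> intro h <;> linear_combination h

/-- A nonempty fibre of `t ↦ t ^ r - t` has `r` elements. -/
lemma ncard_powSubSelf_fiber [Finite F] {d : ℕ} (hr : 2 ≤ r)
    (hadd : ∀ x y : F, (x + y) ^ r = x ^ r + y ^ r) (hF : Nat.card F = r ^ d) (s : F) :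
    {t : F | t ^ r - t = s ^ r - s}.ncard = r := by
  have : {t : F | t ^ r - t = s ^ r - s} = (fun x => s + x) '' {x : F | x ^ r = x} := by
    ext t
    simp only [Set.mem_ofPred_eq, powSubSelf_eq_iff hr hadd, Set.mem_image]
    constructor
    · intro h; exact ⟨t - s, h, by ring⟩
    · rintro ⟨x, hx, rfl⟩; simpa using hx
  rw [this, Set.ncard_image_of_injective _ (add_right_injective s), ncard_pow_eq hr hF]

/-- A set `T` that is a union of fibres of `t ↦ t ^ r - t` is `r` times as large as its image. -/
lemma ncard_powSubSelf_image [Finite F] {d : ℕ} (hr : 2 ≤ r)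
    (hadd : ∀ x y : F, (x + y) ^ r = x ^ r + y ^ r) (hF : Nat.card F = r ^ d)
    (T : Set F) (hT : ∀ s ∈ T, ∀ t, t ^ r - t = s ^ r - s → t ∈ T) :
    T.ncard = r * ((fun t => t ^ r - t) '' T).ncard := by
  classical
  have := Fintype.ofFinite F
  rw [Set.ncard_eq_toFinset_card', Set.ncard_eq_toFinset_card', Set.toFinset_image,
    Finset.card_eq_sum_card_image (fun t : F => t ^ r - t), Finset.sum_const_nat (m := r), mul_comm]
  intro y hy
  obtain ⟨s, hs, rfl⟩ := Finset.mem_image.1 hy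
  refine Eq.trans ?_ (ncard_powSubSelf_fiber hr hadd hF s)
  rw [Set.ncard_eq_toFinset_card']
  congr 1
  ext t
  simp only [Finset.mem_filter, Set.mem_toFinset, Set.mem_ofPred_eq]
  exact ⟨fun h => h.2, fun h => ⟨hT s (by simpa using hs) t h, h⟩⟩

lemma mul_ncard_range_powSubSelf [Finite F] {d : ℕ} (hr : 2 ≤ r)
    (hadd : ∀ x y : F, (x + y) ^ r = x ^ r + y ^ r) (hF : Nat.card F = r ^ d) :
    r * (Set.range fun t : F => t ^ r - t).ncard = r ^ d := by
  rw [← hF, ← Set.image_univ, ← ncard_powSubSelf_image hr hadd hF _ (by simp), Set.ncard_univ]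

lemma ncard_pow_eq_neg_le (hr : 2 ≤ r) : {v : F | v ^ r = -v}.ncard ≤ r := by
  classical
  have hdeg : (X ^ r + X : F[X]).natDegree = r := by
    rw [natDegree_add_eq_left_of_natDegree_lt] <;> simp; omega
  have h0 : (X ^ r + X : F[X]) ≠ 0 := by
    intro h; rw [h] at hdeg; simp at hdeg; omega
  have : {v : F | v ^ r = -v} ⊆ ((X ^ r + X : F[X]).roots.toFinset : Set F) := by
    intro v hv
    have hv' : v ^ r = -v := hv
    simp [h0, hv']
  calc _ ≤ ((X ^ r + X : F[X]).roots.toFinset : Set F).ncard := Set.ncard_le_ncard this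
    _ ≤ r := by
      rw [Set.ncard_coe_finset]
      exact (Multiset.toFinset_card_le _).trans ((card_roots' _).trans hdeg.le)

/-- For `d` even, all solutions of `v ^ r = -v` are of the form `t ^ r - t`, and there are `r`. -/
lemma pow_eq_neg_of_even [Finite F] {d : ℕ} (hr : 2 ≤ r)
    (hadd : ∀ x y : F, (x + y) ^ r = x ^ r + y ^ r) (hF : Nat.card F = r ^ d)
    (he : Even d) : {v : F | v ^ r = -v}.ncard = r ∧
      {v : F | v ^ r = -v} ⊆ Set.range fun t : F => t ^ r - t := by
  -- `T` is the subfield with r^2 elements. Its image under t^r - t consists of solutions and has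
  -- r^2 / r = r elements, which meets the upper bound given by the degree of X^r + X.
  set T : Set F := {t | t ^ r ^ 2 = t}
  have hTc : T.ncard = r ^ 2 := ncard_pow_eq_self hr hF two_pos he.two_dvd
  have key : ∀ t : F, t ∈ T ↔ (t ^ r - t) ^ r = -(t ^ r - t) := by
    intro t
    rw [sub_pow_of_pow_add hr hadd, ← pow_mul, ← pow_two]
    simp only [T, Set.mem_ofPred_eq]
    constructor <;> intro h <;> linear_combination h
  have h1 := ncard_powSubSelf_image hr hadd hF T (by
    intro s hs t h
    rw [key] at hs ⊢
    rw [h, hs])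
  rw [hTc, pow_two] at h1
  have h2 : ((fun t : F => t ^ r - t) '' T).ncard = r :=
    (Nat.eq_of_mul_eq_mul_left (by omega) h1).symm
  have h3 : (fun t : F => t ^ r - t) '' T ⊆ {v : F | v ^ r = -v} := by
    rintro _ ⟨t, ht, rfl⟩
    exact (key t).1 ht
  have h4 := Set.eq_of_subset_of_ncard_le h3 (by rw [h2]; exact ncard_pow_eq_neg_le hr)
    (Set.toFinite _)
  rw [← h4]
  exact ⟨h2, Set.image_subset_range _ _⟩

lemma pow_card_eq [Finite F] {d : ℕ} (hF : Nat.card F = r ^ d) (x : F) : x ^ r ^ d = x := by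
  have := Fintype.ofFinite F
  rw [← hF, Nat.card_eq_fintype_card, FiniteField.pow_card]

/-- The hypothesis says t^(r^2) = t. As d is odd, t^(r^d) = t then collapses to t^r = t. -/
lemma pow_eq_neg_range_of_odd [Finite F] {d : ℕ} (hr : 2 ≤ r)
    (hadd : ∀ x y : F, (x + y) ^ r = x ^ r + y ^ r) (hF : Nat.card F = r ^ d)
    (ho : Odd d) {t : F} (ht : (t ^ r - t) ^ r = -(t ^ r - t)) : t ^ r - t = 0 := by
  rw [sub_pow_of_pow_add hr hadd, ← pow_mul, ← pow_two] at ht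
  have h2 : t ^ r ^ 2 = t := by linear_combination ht
  obtain ⟨k, rfl⟩ := ho
  have h3 : ∀ k : ℕ, t ^ r ^ (2 * k) = t := by
    intro k
    induction k with
    | zero => simp
    | succ k ih => rw [mul_add, pow_add, pow_mul, ih, mul_one, h2]
  have h4 := pow_card_eq hF t
  rw [pow_add, pow_mul, h3, pow_one] at h4
  rw [h4, sub_self]

/-- Iterating v^r = -v an odd number d of times gives v = -v, and the characteristic is odd. -/
lemma ncard_pow_eq_neg_of_odd [Finite F] {d : ℕ} (hr : 2 ≤ r) (hF : Nat.card F = r ^ d)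
    (hor : Odd r) (ho : Odd d) : {v : F | v ^ r = -v}.ncard = 1 := by
  rw [Set.ncard_eq_one]
  refine ⟨0, ?_⟩
  ext v
  simp only [Set.mem_ofPred_eq, Set.mem_singleton_iff]
  refine ⟨fun hv => ?_, ?_⟩
  · have h3 : ∀ k : ℕ, v ^ r ^ k = (-1) ^ k * v := by
      intro k
      induction k with
      | zero => simp
      | succ k ih => rw [pow_succ, pow_mul, ih, mul_pow, hv, pow_right_comm, hor.neg_one_pow]; ring
    have h4 := pow_card_eq hF v
    rw [h3, ho.neg_one_pow] at h4
    have h5 : (2 : F) * v = 0 := by linear_combination -h4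
    have h6 : (2 : F) ≠ 0 := by
      intro h2
      have := Fintype.ofFinite F
      have h8 : CharP F 2 := CharTwo.of_one_ne_zero_of_two_eq_zero one_ne_zero h2
      have h9 := FiniteField.even_card_of_char_two (F := F) (ringChar.eq F 2)
      rw [← Nat.card_eq_fintype_card, hF] at h9
      have := (hor.pow : Odd (r ^ d))
      rw [Nat.odd_iff] at this
      omega
    exact (mul_eq_zero.1 h5).resolve_left h6
  · rintro rfl
    simp [show r ≠ 0 by omega]

lemma ncard_pow_eq_neg_of_even [Finite F] {d : ℕ} (hr : 2 ≤ r)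
    (hd : 0 < d) (hF : Nat.card F = r ^ d)
    (her : Even r) : {v : F | v ^ r = -v}.ncard = r := by
  have := Fintype.ofFinite F
  have h2 : ringChar F = 2 := by
    rw [FiniteField.even_card_iff_char_two, ← Nat.card_eq_fintype_card, hF]
    exact Nat.even_iff.1 (her.pow_of_ne_zero hd.ne')
  have : CharP F 2 := ringChar.of_eq h2
  simp_rw [CharTwo.neg_eq]
  exact ncard_pow_eq hr hF

end FrobeniusCounts

/-! ### Decompositions as roots, and reduction to a one-parameter family. -/

section Collisions

variable {F : Type*} [Field F] {r : ℕ}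

lemma IsAdditive.exists_eq_pow_of_coeff_ne_zero {f : F[X]} (hf : IsAdditive r f) {n : ℕ}
    (hn : f.coeff n ≠ 0) : ∃ i, n = r ^ i := by
  obtain ⟨m, a, rfl⟩ := hf
  rw [finsetSum_coeff] at hn
  obtain ⟨i, -, hi⟩ := Finset.exists_ne_zero_of_sum_ne_zero hn
  refine ⟨i, ?_⟩
  by_contra h
  simp [coeff_X_pow, h] at hi

lemma isAdditive_X_pow_add_C_mul_X (a : F) : IsAdditive r (X ^ r + C a * X) :=
  ⟨1, fun i => if i = 0 then a else 1, by simp [Finset.sum_range_succ, add_comm]⟩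

lemma natDegree_X_pow_add_C_mul_X (hr : 2 ≤ r) (a : F) : (X ^ r + C a * X).natDegree = r := by
  rw [natDegree_add_eq_left_of_natDegree_lt, natDegree_X_pow]
  rw [natDegree_X_pow]
  exact ((natDegree_C_mul_le _ _).trans natDegree_X_le).trans_lt (by omega)

lemma monic_X_pow_add_C_mul_X (hr : 2 ≤ r) (a : F) : (X ^ r + C a * X).Monic := by
  apply monic_X_pow_add
  exact (degree_C_mul_X_le a).trans_lt (by exact_mod_cast (by omega : 1 < r))

lemma IsAdditive.eq_X_pow_add_C_mul_X (hr : 2 ≤ r) {f : F[X]} (hf : IsAdditive r f)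
    (hm : f.Monic) (hdeg : f.natDegree = r) : f = X ^ r + C (f.coeff 1) * X := by
  ext n
  rw [coeff_add, coeff_X_pow, coeff_C_mul, coeff_X]
  by_cases hn : f.coeff n = 0
  · rw [hn]
    have h1 : n ≠ r := by
      rintro rfl
      rw [← hdeg] at hn
      exact one_ne_zero (hm.symm.trans hn)
    by_cases h2 : n = 1
    · subst h2; simp [h1, hn]
    · simp [h1, Ne.symm h2]
  · obtain ⟨i, rfl⟩ := hf.exists_eq_pow_of_coeff_ne_zero hn
    have hle : r ^ i ≤ r ^ 1 := by
      rw [pow_one]; exact (le_natDegree_of_ne_zero hn).trans hdeg.le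
    have hi := (Nat.pow_le_pow_iff_right (by omega : 1 < r)).1 hle
    interval_cases i
    · simp [show 1 ≠ r by omega]
    · have h1 : f.coeff r = 1 := by
        have := hm.coeff_natDegree
        rwa [hdeg] at this
      simp [h1, show 1 ≠ r by omega]

lemma X_pow_add_C_mul_X_comp (haddX : ∀ x y : F[X], (x + y) ^ r = x ^ r + y ^ r) (g h : F) :
    (X ^ r + C g * X).comp (X ^ r + C h * X) =
      X ^ (r ^ 2) + C (h ^ r + g) * X ^ r + C (g * h) * X := by
  simp only [add_comp, pow_comp, X_comp, mul_comp, C_comp]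
  rw [haddX, mul_pow, ← pow_mul, ← pow_two, C_add, C_mul, C_pow]
  ring

lemma coeff_trinomial (hr : 2 ≤ r) (a b : F) :
    (X ^ (r ^ 2) + C a * X ^ r + C b * X).coeff r = a ∧
      (X ^ (r ^ 2) + C a * X ^ r + C b * X).coeff 1 = b := by
  have h1 : r ≠ r ^ 2 := by nlinarith
  have h2 : 1 ≠ r ^ 2 := by nlinarith
  constructor
  · simp [coeff_X_pow, coeff_X, h1, show 1 ≠ r by omega]
  · simp [coeff_X_pow, h2, show 1 ≠ r by omega]

lemma natDegree_trinomial (hr : 2 ≤ r) (a b : F) :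
    (X ^ (r ^ 2) + C a * X ^ r + C b * X).natDegree = r ^ 2 := by
  have h1 : r < r ^ 2 := by nlinarith
  rw [add_assoc, natDegree_add_eq_left_of_natDegree_lt, natDegree_X_pow]
  rw [natDegree_X_pow]
  refine (natDegree_add_le _ _).trans_lt (max_lt ?_ ?_)
  · exact (natDegree_C_mul_X_pow_le a r).trans_lt h1
  · exact ((natDegree_C_mul_le _ _).trans natDegree_X_le).trans_lt (by omega)

/-- The decompositions of `x^(r^2) + a x^r + b x` are `(x^r + g x, x^r + h x)` with
`h^r + g = a` and `g h = b`. -/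
lemma isDecomposition_trinomial_iff (hr : 2 ≤ r)
    (haddX : ∀ x y : F[X], (x + y) ^ r = x ^ r + y ^ r) (a b : F) (G H : F[X]) :
    IsDecomposition r (X ^ (r ^ 2) + C a * X ^ r + C b * X) G H ↔
      ∃ g h : F, G = X ^ r + C g * X ∧ H = X ^ r + C h * X ∧ h ^ r + g = a ∧ g * h = b := by
  constructor
  · rintro ⟨hG, hH, hGm, hHm, hG2, hH2, hf⟩
    have hdeg := natDegree_trinomial hr a b
    rw [hf, natDegree_comp] at hdeg
    -- Both degrees are powers of r with product r^2, and neither is 1, so both equal r.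
    obtain ⟨i, hi⟩ := hG.exists_eq_pow_of_coeff_ne_zero (n := G.natDegree)
      (by rw [hGm.coeff_natDegree]; exact one_ne_zero)
    obtain ⟨j, hj⟩ := hH.exists_eq_pow_of_coeff_ne_zero (n := H.natDegree)
      (by rw [hHm.coeff_natDegree]; exact one_ne_zero)
    rw [hi, hj, ← pow_add] at hdeg
    have hij := Nat.pow_right_injective hr hdeg
    have hi0 : i ≠ 0 := by rintro rfl; simp at hi; omega
    have hj0 : j ≠ 0 := by rintro rfl; simp at hj; omega
    obtain rfl : i = 1 := by omega
    obtain rfl : j = 1 := by omega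
    rw [pow_one] at hi hj
    have hG' := hG.eq_X_pow_add_C_mul_X hr hGm hi
    have hH' := hH.eq_X_pow_add_C_mul_X hr hHm hj
    refine ⟨_, _, hG', hH', ?_⟩
    rw [hG', hH', X_pow_add_C_mul_X_comp haddX] at hf
    have h1 := coeff_trinomial hr a b
    rw [hf] at h1
    have h2 := coeff_trinomial hr (H.coeff 1 ^ r + G.coeff 1) (G.coeff 1 * H.coeff 1)
    exact ⟨h2.1.symm.trans h1.1, h2.2.symm.trans h1.2⟩
  · rintro ⟨g, h, rfl, rfl, rfl, rfl⟩
    refine ⟨isAdditive_X_pow_add_C_mul_X g, isAdditive_X_pow_add_C_mul_X h,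
      monic_X_pow_add_C_mul_X hr g, monic_X_pow_add_C_mul_X hr h, ?_, ?_,
      (X_pow_add_C_mul_X_comp haddX g h).symm⟩
    · rwa [natDegree_X_pow_add_C_mul_X hr]
    · rwa [natDegree_X_pow_add_C_mul_X hr]

lemma numRoots_Psi_two (hr : 2 ≤ r) (a b : F) :
    numRoots (Psi r 2 a b) = {x : F | x ^ (r + 1) + a * x + b = 0}.ncard := by
  have h : (r ^ 2 - 1) / (r - 1) = r + 1 := by
    rw [show r ^ 2 - 1 = (r + 1) * (r - 1) by simpa using Nat.sq_sub_sq r 1]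
    exact Nat.mul_div_cancel _ (by omega)
  simp [numRoots, Psi, h]

/-- With h = -x the first equation forces g = a + x^r, and g h = b becomes the projective equation
in x. -/
lemma ncard_decompositions (hr : 2 ≤ r) (hadd : ∀ x y : F, (x + y) ^ r = x ^ r + y ^ r)
    (haddX : ∀ x y : F[X], (x + y) ^ r = x ^ r + y ^ r) (a b : F) :
    {P : F[X] × F[X] | IsDecomposition r (X ^ (r ^ 2) + C a * X ^ r + C b * X) P.1 P.2}.ncard =
      numRoots (Psi r 2 a b) := by
  rw [numRoots_Psi_two hr]
  symm
  refine Set.ncard_congr (fun x _ => (X ^ r + C (a + x ^ r) * X, X ^ r + C (-x) * X)) ?_ ?_ ?_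
  · intro x hx
    have hx' : x ^ (r + 1) + a * x + b = 0 := hx
    refine (isDecomposition_trinomial_iff hr haddX a b _ _).2 ⟨_, _, rfl, rfl, ?_, ?_⟩
    · rw [neg_pow_of_pow_add hr hadd]; ring
    · linear_combination -hx'
  · intro x y _ _ hxy
    have h := congrArg (fun P : F[X] × F[X] => P.2.coeff 1) hxy
    simpa [coeff_X_pow, show 1 ≠ r by omega] using h
  · rintro ⟨G, H⟩ hP
    obtain ⟨g, h, h1, h2, h3, h4⟩ := (isDecomposition_trinomial_iff hr haddX a b _ _).1 hP
    dsimp only at h1 h2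
    have h5 := neg_pow_of_pow_add hr hadd h
    refine ⟨-h, ?_, ?_⟩
    · rw [Set.mem_ofPred_eq, pow_succ, h5, ← h3, ← h4]; ring
    · rw [h1, h2, h5, ← h3, neg_neg, add_neg_cancel_comm]

/-- The decompositions all have left degree r, so any set of them is a collision. One that misses a
decomposition can be enlarged; the full set cannot. -/
lemma hasMaximalCollision_iff [Finite F] (hr : 2 ≤ r)
    (hadd : ∀ x y : F, (x + y) ^ r = x ^ r + y ^ r)
    (haddX : ∀ x y : F[X], (x + y) ^ r = x ^ r + y ^ r) (a b : F) (i : ℕ) :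
    HasMaximalCollision r (X ^ (r ^ 2) + C a * X ^ r + C b * X) i ↔
      numRoots (Psi r 2 a b) = i := by
  classical
  set f : F[X] := X ^ (r ^ 2) + C a * X ^ r + C b * X with hf
  set D : Set (F[X] × F[X]) := {P | IsDecomposition r f P.1 P.2} with hD
  have hdeg : ∀ P ∈ D, P.1.natDegree = r := by
    intro P hP
    obtain ⟨g, h, h1, -⟩ := (isDecomposition_trinomial_iff hr haddX a b _ _).1 hP
    rw [h1, natDegree_X_pow_add_C_mul_X hr]
  have hfin : D.Finite := by
    refine (Set.finite_range fun p : F × F => (X ^ r + C p.1 * X, X ^ r + C p.2 * X)).subset ?_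
    intro P hP
    obtain ⟨g, h, h1, h2, -⟩ := (isDecomposition_trinomial_iff hr haddX a b _ _).1 hP
    exact ⟨(g, h), Prod.ext h1.symm h2.symm⟩
  rw [← ncard_decompositions hr hadd haddX a b, ← hf, ← hD]
  have hcoll : ∀ (j : ℕ) (S : Finset (F[X] × F[X])),
      IsCollision r f j S ↔ S.card = j ∧ (S : Set (F[X] × F[X])) ⊆ D := fun j S =>
    ⟨fun h => ⟨h.1, h.2.1⟩, fun h => ⟨h.1, h.2, r, fun P hP => hdeg P (h.2 hP)⟩⟩
  constructor
  · rintro ⟨S, hS, hmax⟩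
    obtain ⟨hc, hSD⟩ := (hcoll i S).1 hS
    have : (S : Set (F[X] × F[X])) = D := by
      refine hSD.antisymm fun P hP => ?_
      by_contra hPS
      have hPS' : P ∉ S := hPS
      refine hmax ⟨insert P S, (hcoll _ _).2 ⟨by rw [Finset.card_insert_of_notMem hPS', hc], ?_⟩,
        Finset.subset_insert P S⟩
      rw [Finset.coe_insert]
      exact Set.insert_subset hP hSD
    rw [← this, Set.ncard_coe_finset, hc]
  · intro h
    refine ⟨hfin.toFinset, (hcoll _ _).2 ⟨by rw [← h, Set.ncard_eq_toFinset_card _ hfin], by simp⟩,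
      ?_⟩
    rintro ⟨T, hT, -⟩
    obtain ⟨hc, hTD⟩ := (hcoll _ _).1 hT
    have := Set.ncard_le_ncard hTD hfin
    rw [Set.ncard_coe_finset, hc, h] at this
    omega

/-- Substituting `x = c y` turns `x^(r+1) - u c^r x + u c^(r+1)` into a multiple of
`y^(r+1) - u y + u`. -/
lemma ncard_roots_scale {c u : F} (hc : c ≠ 0) :
    {x : F | x ^ (r + 1) + (-(u * c ^ r)) * x + u * c ^ (r + 1) = 0}.ncard =
      {x : F | x ^ (r + 1) - u * x + u = 0}.ncard := by
  have : {x : F | x ^ (r + 1) + (-(u * c ^ r)) * x + u * c ^ (r + 1) = 0} =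
      (fun y => c * y) '' {x : F | x ^ (r + 1) - u * x + u = 0} := by
    ext x
    simp only [Set.mem_image, Set.mem_ofPred_eq]
    constructor
    · intro h
      refine ⟨x / c, ?_, by field_simp⟩
      apply mul_left_cancel₀ (pow_ne_zero (r + 1) hc)
      rw [mul_zero, ← h, div_pow]
      field_simp
      ring
    · rintro ⟨y, hy, rfl⟩
      linear_combination c ^ (r + 1) * hy
  rw [this, Set.ncard_image_of_injective _ (mul_right_injective₀ hc)]

lemma numRoots_bluher (u : F) : numRoots (X ^ (r + 1) - C u * X + C u : F[X]) =
    {x : F | x ^ (r + 1) - u * x + u = 0}.ncard := by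
  simp [numRoots]

/-- The map (c, u) ↦ (-u c^r, u c^(r+1)) is a bijection from pairs of units to pairs with ab ≠ 0,
and it preserves the number of roots. -/
lemma c2_eq_mul_bluherCount [Finite F] (hr : 2 ≤ r) (i : ℕ) :
    c2 F r 2 i = (Nat.card F - 1) * bluherCount F r i := by
  have h0 : {c : F | c ≠ 0}.ncard = Nat.card F - 1 := by
    have := ncard_ne_zero_add_one (F := F) (Set.mem_univ 0)
    rw [Set.ncard_univ] at this
    simp only [Set.mem_univ, and_true] at this
    omega
  rw [c2, bluherCount, ← h0, ← Set.ncard_prod]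
  symm
  refine Set.ncard_congr (fun p _ => (-(p.2 * p.1 ^ r), p.2 * p.1 ^ (r + 1))) ?_ ?_ ?_
  · rintro ⟨c, u⟩ ⟨hc, hu, hn⟩
    have hc' : c ≠ 0 := hc
    refine ⟨?_, ?_⟩
    · rw [numRoots_Psi_two hr, ← hn, numRoots_bluher]
      exact ncard_roots_scale hc'
    · exact mul_ne_zero (neg_ne_zero.2 (mul_ne_zero hu (pow_ne_zero _ hc)))
        (mul_ne_zero hu (pow_ne_zero _ hc))
  · rintro ⟨c, u⟩ ⟨c', u'⟩ ⟨hc, hu, -⟩ ⟨hc', hu', -⟩ h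
    dsimp only at hc hu hc' hu' h
    rw [Prod.mk.injEq] at h
    obtain ⟨h1, h2⟩ := h
    have h1' : u * c ^ r = u' * c' ^ r := neg_injective h1
    have h3 : c = c' := by
      rw [pow_succ, pow_succ, ← mul_assoc, ← mul_assoc, h1'] at h2
      exact mul_left_cancel₀ (mul_ne_zero hu' (pow_ne_zero _ hc')) h2
    subst h3
    rw [mul_right_cancel₀ (pow_ne_zero _ hc) h1']
  · rintro ⟨a, b⟩ ⟨hn, hab⟩
    dsimp only at hn hab
    have ha := left_ne_zero_of_mul hab
    have hb := right_ne_zero_of_mul hab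
    -- The scale c is recovered as minus the ratio of the two coefficients.
    have hc : -b / a ≠ 0 := div_ne_zero (neg_ne_zero.2 hb) ha
    have hb' : b / (-b / a) ^ (r + 1) * (-b / a) ^ (r + 1) = b :=
      div_mul_cancel₀ _ (pow_ne_zero _ hc)
    have ha' : -(b / (-b / a) ^ (r + 1) * (-b / a) ^ r) = a := by
      rw [pow_succ, ← div_div, div_right_comm, div_mul_cancel₀ _ (pow_ne_zero _ hc)]
      field_simp
    refine ⟨(-b / a, b / (-b / a) ^ (r + 1)), ⟨hc, div_ne_zero hb (pow_ne_zero _ hc), ?_⟩, ?_⟩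
    · dsimp only
      rw [numRoots_bluher, ← ncard_roots_scale hc, ha', hb', ← hn, numRoots_Psi_two hr]
    · dsimp only
      rw [ha', hb']

end Collisions

/-! ### Counting the u by the number of roots of x^(r+1) - u x + u. -/

section RootCounts

variable {F : Type*} [Field F] {r : ℕ}

/-- If `y + 1` is a root of `x^(r+1) - u x + u`, its other roots are `(y + 1) (1 + s⁻¹)`, where `s`
runs through the elements of this set. -/
def otherRoots (r : ℕ) (y : F) : Set F := {s | s ^ r = y * (s + 1)}

/-- The `y` for which `y + 1` is one of exactly `i` roots of a polynomial `x^(r+1) - u x + u`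
with `u ≠ 0`. -/
def rootsOfType (F : Type*) [Field F] (r i : ℕ) : Set F :=
  {y | (y ≠ 0 ∧ y ≠ -1) ∧ 1 + (otherRoots r y).ncard = i}

lemma ncard_roots_eq [Finite F] (hr : 2 ≤ r) (hadd : ∀ x y : F, (x + y) ^ r = x ^ r + y ^ r)
    {u y : F} (hy : y ≠ 0) (hu : (y + 1) ^ (r + 1) = u * y) (hy1 : y + 1 ≠ 0) :
    {x : F | x ^ (r + 1) - u * x + u = 0}.ncard = 1 + (otherRoots r y).ncard := by
  have hs0 : ∀ s ∈ otherRoots r y, s ≠ 0 := by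
    rintro s hs rfl
    rw [otherRoots, Set.mem_ofPred_eq, zero_pow (by omega), zero_add, mul_one] at hs
    exact hy hs.symm
  have key : ∀ s : F, s ≠ 0 → (((y + 1) * (1 + s⁻¹)) ^ (r + 1) - u * ((y + 1) * (1 + s⁻¹)) + u = 0
      ↔ s ^ r = y * (s + 1)) := by
    intro s hs
    -- Additivity splits (1 + 1/s)^r into 1 + 1/s^r. After u y replaces (y+1)^(r+1), the s^(r+1)
    -- terms cancel.
    have h1 : ((y + 1) * (1 + s⁻¹)) ^ (r + 1) - u * ((y + 1) * (1 + s⁻¹)) + u =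
        u * (s ^ (r + 1))⁻¹ * (y * (s + 1) - s ^ r) := by
      rw [mul_pow, hu, pow_succ (1 + s⁻¹), hadd, one_pow, inv_pow]
      field_simp
      ring
    have hu0 : u ≠ 0 := by
      rintro rfl
      rw [zero_mul] at hu
      exact pow_ne_zero _ hy1 hu
    rw [h1, mul_eq_zero, sub_eq_zero, eq_comm (a := s ^ r)]
    exact or_iff_right (mul_ne_zero hu0 (inv_ne_zero (pow_ne_zero _ hs)))
  have h1 : {x : F | x ^ (r + 1) - u * x + u = 0} =
      insert (y + 1) ((fun s => (y + 1) * (1 + s⁻¹)) '' otherRoots r y) := by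
    ext x
    simp only [Set.mem_insert_iff, Set.mem_image, Set.mem_ofPred_eq]
    constructor
    · intro hx
      by_cases hxy : x = y + 1
      · exact Or.inl hxy
      · right
        have h2 : x - (y + 1) ≠ 0 := sub_ne_zero.2 hxy
        have h3 : (y + 1) * (1 + ((y + 1) / (x - (y + 1)))⁻¹) = x := by
          field_simp
          ring
        refine ⟨(y + 1) / (x - (y + 1)), ?_, h3⟩
        have := key _ (div_ne_zero hy1 h2)
        rw [h3] at this
        exact this.1 hx
    · rintro (rfl | ⟨s, hs, rfl⟩)
      · rw [hu]; ring
      · exact (key s (hs0 s hs)).2 hs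
  rw [h1, Set.ncard_insert_of_notMem, Set.InjOn.ncard_image, add_comm]
  · intro s _ t _ hst
    exact inv_injective (add_left_cancel (mul_left_cancel₀ hy1 hst))
  · rintro ⟨s, hs, h⟩
    have h2 : (y + 1) * s⁻¹ = 0 := by linear_combination h
    exact mul_ne_zero hy1 (inv_ne_zero (hs0 s hs)) h2

/-- The additive map s ↦ s^r - y s has trivial kernel, so on a finite field it is bijective and
takes the value y once. -/
lemma ncard_otherRoots_of_not_pow [Finite F] (hr : 2 ≤ r)
    (hadd : ∀ x y : F, (x + y) ^ r = x ^ r + y ^ r) {y : F}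
    (hy : ¬ ∃ w : F, w ≠ 0 ∧ y = w ^ (r - 1)) : (otherRoots r y).ncard = 1 := by
  have hinj : Function.Injective fun s : F => s ^ r - y * s := by
    intro s t hst
    by_contra hne
    have h0 : s - t ≠ 0 := sub_ne_zero.2 hne
    have h1 : (s - t) ^ r = y * (s - t) := by
      rw [sub_pow_of_pow_add hr hadd]
      linear_combination hst
    refine hy ⟨s - t, h0, ?_⟩
    rw [show r = r - 1 + 1 by omega, pow_succ] at h1
    exact (mul_right_cancel₀ h0 h1).symm
  obtain ⟨s, hs⟩ := (Finite.injective_iff_surjective.1 hinj) y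
  rw [Set.ncard_eq_one]
  refine ⟨s, ?_⟩
  ext t
  simp only [otherRoots, Set.mem_ofPred_eq, Set.mem_singleton_iff]
  dsimp only at hs
  constructor
  · intro ht
    apply hinj
    dsimp only
    rw [hs, ht]; ring
  · rintro rfl
    linear_combination hs

/-- The substitution s = t w turns the equation into one of Artin–Schreier type. -/
lemma ncard_otherRoots_pow (hr : 2 ≤ r) {w : F} (hw : w ≠ 0) :
    (otherRoots r (w ^ (r - 1))).ncard = {t : F | t ^ r - t = w⁻¹}.ncard := by
  have : otherRoots r (w ^ (r - 1)) = (fun t => t * w) '' {t : F | t ^ r - t = w⁻¹} := by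
    have key : ∀ t : F, (t * w) ^ r = w ^ (r - 1) * (t * w + 1) ↔ t ^ r - t = w⁻¹ := by
      intro t
      have h1 : (t * w) ^ r - w ^ (r - 1) * (t * w + 1) = w ^ r * (t ^ r - t - w⁻¹) := by
        obtain ⟨m, rfl⟩ : ∃ m, r = m + 1 := ⟨r - 1, by omega⟩
        rw [Nat.add_sub_cancel, mul_pow]
        field_simp
        ring
      rw [← sub_eq_zero, h1, mul_eq_zero, sub_eq_zero]
      exact or_iff_right (pow_ne_zero _ hw)
    ext s
    simp only [otherRoots, Set.mem_image, Set.mem_ofPred_eq]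
    constructor
    · intro hs
      refine ⟨s / w, ?_, div_mul_cancel₀ _ hw⟩
      rw [← key, div_mul_cancel₀ _ hw, hs]
    · rintro ⟨t, ht, rfl⟩
      exact (key t).2 ht
  rw [this, Set.ncard_image_of_injective _ (mul_left_injective₀ hw)]

lemma ncard_otherRoots_pow_of_mem [Finite F] {d : ℕ} (hr : 2 ≤ r)
    (hadd : ∀ x y : F, (x + y) ^ r = x ^ r + y ^ r) (hF : Nat.card F = r ^ d) {w : F} (hw : w ≠ 0)
    (h : w⁻¹ ∈ Set.range fun t : F => t ^ r - t) : (otherRoots r (w ^ (r - 1))).ncard = r := by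
  obtain ⟨s, hs⟩ := h
  rw [ncard_otherRoots_pow hr hw, ← hs, ncard_powSubSelf_fiber hr hadd hF s]

lemma ncard_otherRoots_pow_of_notMem (hr : 2 ≤ r) {w : F} (hw : w ≠ 0)
    (h : w⁻¹ ∉ Set.range fun t : F => t ^ r - t) : (otherRoots r (w ^ (r - 1))).ncard = 0 := by
  rw [ncard_otherRoots_pow hr hw]
  convert Set.ncard_empty F
  ext t
  simp only [Set.mem_ofPred_eq, Set.mem_empty_iff_false, iff_false]
  exact fun ht => h ⟨t, ht⟩

lemma ncard_otherRoots_mem [Finite F] {d : ℕ} (hr : 2 ≤ r)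
    (hadd : ∀ x y : F, (x + y) ^ r = x ^ r + y ^ r) (hF : Nat.card F = r ^ d) (y : F) :
    1 + (otherRoots r y).ncard ∈ ({1, 2, r + 1} : Finset ℕ) := by
  simp only [Finset.mem_insert, Finset.mem_singleton]
  by_cases hy : ∃ w : F, w ≠ 0 ∧ y = w ^ (r - 1)
  · obtain ⟨w, hw, rfl⟩ := hy
    by_cases h : w⁻¹ ∈ Set.range fun t : F => t ^ r - t
    · rw [ncard_otherRoots_pow_of_mem hr hadd hF hw h]; omega
    · rw [ncard_otherRoots_pow_of_notMem hr hw h]; omega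
  · rw [ncard_otherRoots_of_not_pow hr hadd hy]; omega

/-- Double counting of pairs (u, root): the fibre of y ↦ (y+1)^(r+1)/y over u is the root set
shifted by 1. No root is 0 or 1, which is why y = -1 and y = 0 are excluded. -/
lemma mul_bluherCount [Finite F] (hr : 2 ≤ r) (hadd : ∀ x y : F, (x + y) ^ r = x ^ r + y ^ r)
    (i : ℕ) : i * bluherCount F r i = (rootsOfType F r i).ncard := by
  classical
  have := Fintype.ofFinite F
  rw [bluherCount, Set.ncard_eq_toFinset_card', Set.ncard_eq_toFinset_card',
    Finset.card_eq_sum_card_fiberwise (s := (rootsOfType F r i).toFinset)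
      (f := fun y : F => (y + 1) ^ (r + 1) / y)
      (t := {u : F | u ≠ 0 ∧ numRoots (X ^ (r + 1) - C u * X + C u : F[X]) = i}.toFinset)]
  · rw [Finset.sum_const_nat (m := i), mul_comm]
    intro u hu
    rw [Set.mem_toFinset, Set.mem_ofPred_eq, numRoots_bluher] at hu
    obtain ⟨hu0, hu⟩ := hu
    refine Eq.trans ?_ hu
    have hinj : Function.Injective fun y : F => y + 1 := add_left_injective 1
    rw [← Set.ncard_coe_finset, ← Set.ncard_image_of_injective _ hinj]
    congr 1
    ext x
    simp only [Set.mem_image, Finset.coe_filter, Set.mem_toFinset, Set.mem_ofPred_eq]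
    constructor
    · rintro ⟨y, ⟨hy, rfl⟩, rfl⟩
      have := hy.1.1
      field_simp
      ring
    · intro hx
      have hx0 : x ≠ 0 := by
        rintro rfl
        rw [zero_pow (by omega)] at hx
        exact hu0 (by linear_combination hx)
      have hx1 : x - 1 ≠ 0 := by
        intro h
        rw [sub_eq_zero.1 h] at hx
        exact one_ne_zero (α := F) (by linear_combination hx)
      have h1 : (x - 1 + 1) ^ (r + 1) = u * (x - 1) := by
        rw [sub_add_cancel]; linear_combination hx
      refine ⟨x - 1, ⟨⟨⟨hx1, fun h => hx0 (by linear_combination h)⟩, ?_⟩, ?_⟩, sub_add_cancel _ _⟩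
      · rw [← hu, ncard_roots_eq hr hadd hx1 h1 (by rwa [sub_add_cancel])]
      · rw [h1, mul_div_cancel_right₀ _ hx1]
  · intro y hy
    simp only [Set.coe_toFinset] at hy ⊢
    obtain ⟨⟨hy0, hy1⟩, hy⟩ := hy
    have h1 : y + 1 ≠ 0 := fun h => hy1 (by linear_combination h)
    refine ⟨div_ne_zero (pow_ne_zero _ h1) hy0, ?_⟩
    rw [numRoots_bluher, ncard_roots_eq hr hadd hy0 (div_mul_cancel₀ _ hy0).symm h1, hy]

lemma bluherCount_eq_zero [Finite F] {d : ℕ} (hr : 2 ≤ r)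
    (hadd : ∀ x y : F, (x + y) ^ r = x ^ r + y ^ r) (hF : Nat.card F = r ^ d) {i : ℕ}
    (hi : i ∉ ({0, 1, 2, r + 1} : Finset ℕ)) : bluherCount F r i = 0 := by
  simp only [Finset.mem_insert, Finset.mem_singleton, not_or] at hi
  have h := mul_bluherCount hr hadd i
  rw [(Set.ncard_eq_zero (Set.toFinite _)).2, mul_eq_zero] at h
  · exact h.resolve_left hi.1
  · ext y
    simp only [Set.mem_empty_iff_false, iff_false]
    rintro ⟨-, hy⟩
    have := ncard_otherRoots_mem hr hadd hF y
    simp only [Finset.mem_insert, Finset.mem_singleton] at this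
    omega

lemma numRoots_bluher_mem [Finite F] {d : ℕ} (hr : 2 ≤ r)
    (hadd : ∀ x y : F, (x + y) ^ r = x ^ r + y ^ r) (hF : Nat.card F = r ^ d) {u : F} (hu : u ≠ 0) :
    numRoots (X ^ (r + 1) - C u * X + C u : F[X]) ∈ ({0, 1, 2, r + 1} : Finset ℕ) := by
  by_contra hi
  have h := bluherCount_eq_zero (F := F) hr hadd hF hi
  rw [bluherCount, Set.ncard_eq_zero (Set.toFinite _)] at h
  exact Set.notMem_empty u (h ▸ ⟨hu, rfl⟩)

lemma ncard_setOf_ne_zero [Finite F] : {c : F | c ≠ 0}.ncard + 1 = Nat.card F := by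
  have := ncard_ne_zero_add_one (F := F) (Set.mem_univ 0)
  rw [Set.ncard_univ] at this
  simpa using this

lemma sum_bluherCount [Finite F] {d : ℕ} (hr : 2 ≤ r)
    (hadd : ∀ x y : F, (x + y) ^ r = x ^ r + y ^ r) (hF : Nat.card F = r ^ d) :
    bluherCount F r 0 + bluherCount F r 1 + bluherCount F r 2 + bluherCount F r (r + 1) + 1 =
      Nat.card F := by
  classical
  have := Fintype.ofFinite F
  rw [← ncard_setOf_ne_zero, Set.ncard_eq_toFinset_card',
    Finset.card_eq_sum_card_fiberwise
      (f := fun u : F => numRoots (X ^ (r + 1) - C u * X + C u : F[X]))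
      (t := {0, 1, 2, r + 1})]
  · have h : ∀ i, bluherCount F r i = (Finset.filter
        (fun u : F => numRoots (X ^ (r + 1) - C u * X + C u : F[X]) = i)
        {c : F | c ≠ 0}.toFinset).card := by
      intro i
      rw [bluherCount, ← Set.ncard_coe_finset]
      congr 1
      ext u
      simp
    rw [Finset.sum_insert, Finset.sum_insert, Finset.sum_insert, Finset.sum_singleton]
    · simp only [h]; ring
    all_goals simp; try omega
  · intro u hu
    exact numRoots_bluher_mem hr hadd hF (by simpa using hu)

lemma ncard_ne_zero_ne_neg_one [Finite F] : {y : F | y ≠ 0 ∧ y ≠ -1}.ncard + 2 = Nat.card F := by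
  have h : {y : F | y ≠ 0 ∧ y ≠ -1} = {c : F | c ≠ 0} \ {-1} := by
    ext; simp
  rw [← ncard_setOf_ne_zero, h, ← Set.ncard_sdiff_singleton_add_one (s := {c : F | c ≠ 0})
    (a := -1) (by simp)]

lemma sum_rootsOfType [Finite F] {d : ℕ} (hr : 2 ≤ r)
    (hadd : ∀ x y : F, (x + y) ^ r = x ^ r + y ^ r) (hF : Nat.card F = r ^ d) :
    (rootsOfType F r 1).ncard + (rootsOfType F r 2).ncard + (rootsOfType F r (r + 1)).ncard + 2 =
      Nat.card F := by
  classical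
  have := Fintype.ofFinite F
  rw [← ncard_ne_zero_ne_neg_one, Set.ncard_eq_toFinset_card' {y : F | y ≠ 0 ∧ y ≠ -1},
    Finset.card_eq_sum_card_fiberwise (f := fun y : F => 1 + (otherRoots r y).ncard)
      (t := {1, 2, r + 1})]
  · have h : ∀ i, (rootsOfType F r i).ncard = (Finset.filter
        (fun y : F => 1 + (otherRoots r y).ncard = i)
        {y : F | y ≠ 0 ∧ y ≠ -1}.toFinset).card := by
      intro i
      rw [← Set.ncard_coe_finset]
      congr 1
      ext u
      simp [rootsOfType]
    rw [Finset.sum_insert, Finset.sum_insert, Finset.sum_singleton]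
    · simp only [h]; ring
    all_goals simp; try omega
  · intro y _
    exact ncard_otherRoots_mem hr hadd hF y

/-- Two roots occur exactly when y is not an (r-1)-th power of a unit, since powers give 1 or r + 1.
-/
lemma rootsOfType_two [Finite F] {d : ℕ} (hr : 2 ≤ r)
    (hadd : ∀ x y : F, (x + y) ^ r = x ^ r + y ^ r) (hF : Nat.card F = r ^ d) :
    (rootsOfType F r 2).ncard + {y : F | (∃ w : F, w ≠ 0 ∧ y = w ^ (r - 1)) ∧ y ≠ -1}.ncard + 2 =
      Nat.card F := by
  rw [← ncard_ne_zero_ne_neg_one, ← Set.ncard_union_eq]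
  · congr 2
    ext y
    simp only [Set.mem_union, rootsOfType, Set.mem_ofPred_eq]
    constructor
    · rintro (h | ⟨⟨w, hw, rfl⟩, h⟩)
      · exact h.1
      · exact ⟨pow_ne_zero _ hw, h⟩
    · intro h
      by_cases hy : ∃ w : F, w ≠ 0 ∧ y = w ^ (r - 1)
      · exact Or.inr ⟨hy, h.2⟩
      · exact Or.inl ⟨h, by rw [ncard_otherRoots_of_not_pow hr hadd hy]⟩
  · rw [Set.disjoint_left]
    rintro y ⟨-, hy⟩ ⟨⟨w, hw, rfl⟩, -⟩
    by_cases h : w⁻¹ ∈ Set.range fun t : F => t ^ r - t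
    · rw [ncard_otherRoots_pow_of_mem hr hadd hF hw h] at hy; omega
    · rw [ncard_otherRoots_pow_of_notMem hr hw h] at hy; omega

lemma pow_sub_one_eq_neg_one_iff (hr : 2 ≤ r) {w : F} (hw : w ≠ 0) :
    w ^ (r - 1) = -1 ↔ w ^ r = -w := by
  obtain ⟨m, rfl⟩ : ∃ m, r = m + 1 := ⟨r - 1, by omega⟩
  rw [Nat.add_sub_cancel, pow_succ]
  constructor
  · intro h; rw [h, neg_one_mul]
  · intro h; exact mul_right_cancel₀ hw (by rw [h, neg_one_mul])

/-- Each w is either a unit with w^(r-1) ≠ -1 or a solution of w^r = -w; w = 0 falls in the second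
class. -/
lemma mul_ncard_pow_ne_neg_one [Finite F] {d : ℕ} (hr : 2 ≤ r) (hF : Nat.card F = r ^ d) :
    (r - 1) * {y : F | (∃ w : F, w ≠ 0 ∧ y = w ^ (r - 1)) ∧ y ≠ -1}.ncard +
      {v : F | v ^ r = -v}.ncard = Nat.card F := by
  rw [← ncard_pow_preimage hr hF (fun y => y ≠ -1), ← Set.ncard_univ, ← Set.ncard_union_eq]
  · congr 1
    ext w
    simp only [Set.mem_union, Set.mem_ofPred_eq, Set.mem_univ, iff_true]
    by_cases hw : w = 0
    · right
      simp [hw, show r ≠ 0 by omega]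
    · have := pow_sub_one_eq_neg_one_iff hr hw
      tauto
  · rw [Set.disjoint_left]
    rintro w ⟨hw, h1⟩ h2
    exact h1 ((pow_sub_one_eq_neg_one_iff hr hw).2 h2)

/-- Lift y to w and pass to 1/w: r + 1 roots means that 1/w lies in the range of t^r - t, and y ≠ -1
removes the solutions of x^r = -x, zero among them. -/
lemma mul_ncard_rootsOfType_succ [Finite F] {d : ℕ} (hr : 2 ≤ r)
    (hadd : ∀ x y : F, (x + y) ^ r = x ^ r + y ^ r) (hF : Nat.card F = r ^ d) :
    (r - 1) * (rootsOfType F r (r + 1)).ncard =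
      ((Set.range fun t : F => t ^ r - t) \ {v : F | v ^ r = -v}).ncard := by
  have h1 : rootsOfType F r (r + 1) = {y : F | (∃ w : F, w ≠ 0 ∧ y = w ^ (r - 1)) ∧
      (y ≠ -1 ∧ (otherRoots r y).ncard = r)} := by
    ext y
    simp only [rootsOfType, Set.mem_ofPred_eq]
    constructor
    · rintro ⟨⟨-, h1⟩, h2⟩
      refine ⟨?_, h1, by omega⟩
      by_contra hy
      rw [ncard_otherRoots_of_not_pow hr hadd hy] at h2
      omega
    · rintro ⟨⟨w, hw, rfl⟩, h1, h2⟩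
      exact ⟨⟨pow_ne_zero _ hw, h1⟩, by omega⟩
  rw [h1, ← ncard_pow_preimage hr hF (fun y => y ≠ -1 ∧ (otherRoots r y).ncard = r),
    ← Set.ncard_image_of_injective _ (inv_injective (G := F))]
  congr 1
  have hneg : ∀ w : F, w ≠ 0 → (w⁻¹ ^ r = -w⁻¹ ↔ w ^ r = -w) := by
    intro w _
    rw [inv_pow, ← inv_neg, inv_inj]
  ext v
  simp only [Set.mem_image, Set.mem_sdiff, Set.mem_ofPred_eq]
  constructor
  · rintro ⟨w, ⟨hw, h2, h3⟩, rfl⟩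
    rw [hneg w hw, ← pow_sub_one_eq_neg_one_iff hr hw]
    refine ⟨?_, h2⟩
    by_contra h
    rw [ncard_otherRoots_pow_of_notMem hr hw h] at h3
    omega
  · rintro ⟨h2, h3⟩
    have hv : v ≠ 0 := by
      rintro rfl
      exact h3 (by simp [show r ≠ 0 by omega])
    have hv' := inv_ne_zero hv
    refine ⟨v⁻¹, ⟨hv', ?_, ?_⟩, inv_inv v⟩
    · rwa [ne_eq, pow_sub_one_eq_neg_one_iff hr hv', hneg v hv]
    · rw [ncard_otherRoots_pow_of_mem hr hadd hF hv' (by rwa [inv_inv])]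

lemma ncard_range_inter_of_odd [Finite F] {d : ℕ} (hr : 2 ≤ r)
    (hadd : ∀ x y : F, (x + y) ^ r = x ^ r + y ^ r) (hF : Nat.card F = r ^ d) (ho : Odd d) :
    ((Set.range fun t : F => t ^ r - t) ∩ {v : F | v ^ r = -v}).ncard = 1 := by
  rw [Set.ncard_eq_one]
  refine ⟨0, ?_⟩
  ext v
  simp only [Set.mem_inter_iff, Set.mem_singleton_iff]
  constructor
  · rintro ⟨⟨t, rfl⟩, ht⟩
    exact pow_eq_neg_range_of_odd hr hadd hF ho ht
  · rintro rfl
    exact ⟨⟨0, by simp [show r ≠ 0 by omega]⟩, by simp [show r ≠ 0 by omega]⟩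

/-- The numbers of `u ≠ 0` for which `x^(r+1) - u x + u` has `0`, `1`, `2`, `r + 1` roots, in terms
of the number `v` of solutions of `x^r = -x` and the number `e` of those of the form `t^r - t`. -/
lemma bluherCount_formula [Finite F] {d : ℕ} (hr : 2 ≤ r)
    (hadd : ∀ x y : F, (x + y) ^ r = x ^ r + y ^ r) (hF : Nat.card F = r ^ d) {v e : ℕ}
    (hv : {v : F | v ^ r = -v}.ncard = v)
    (he : ((Set.range fun t : F => t ^ r - t) ∩ {v : F | v ^ r = -v}).ncard = e) {q : ℚ}
    (hq : q = Nat.card F) :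
    (bluherCount F r (r + 1) : ℚ) = (q / r - e) / ((r - 1) * (r + 1)) ∧
    (bluherCount F r 2 : ℚ) = (q - 2 - (q - v) / (r - 1)) / 2 ∧
    (bluherCount F r 1 : ℚ) = (q - v) / (r - 1) - (q / r - e) / (r - 1) ∧
    (bluherCount F r 0 : ℚ) = q - 1 - ((q - v) / (r - 1) - (q / r - e) / (r - 1)) -
      (q - 2 - (q - v) / (r - 1)) / 2 - (q / r - e) / ((r - 1) * (r + 1)) := by
  have h1 := sum_bluherCount hr hadd hF
  have h2 := sum_rootsOfType hr hadd hF
  have h3 := rootsOfType_two hr hadd hF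
  have h4 := mul_ncard_pow_ne_neg_one hr hF
  have h5 := mul_ncard_rootsOfType_succ hr hadd hF
  have h6 := mul_ncard_range_powSubSelf hr hadd hF
  have h7 := Set.ncard_inter_add_ncard_sdiff_eq_ncard (Set.range fun t : F => t ^ r - t)
    {v : F | v ^ r = -v} (Set.toFinite _)
  rw [← hF] at h6
  rw [hv] at h4
  rw [he, ← h5] at h7
  rw [← mul_bluherCount hr hadd, ← mul_bluherCount hr hadd, ← mul_bluherCount hr hadd] at h2
  rw [← mul_bluherCount hr hadd] at h3 h7
  generalize {y : F | (∃ w : F, w ≠ 0 ∧ y = w ^ (r - 1)) ∧ y ≠ -1}.ncard = A at *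
  -- What remains is a linear system over ℚ in the four counts.
  generalize (Set.range fun t : F => t ^ r - t).ncard = M at *
  generalize bluherCount F r 0 = N0 at *
  generalize bluherCount F r 1 = N1 at *
  generalize bluherCount F r 2 = N2 at *
  generalize bluherCount F r (r + 1) = N3 at *
  have hr1 : ((r - 1 : ℕ) : ℚ) = r - 1 := by
    rw [Nat.cast_sub (by omega), Nat.cast_one]
  have hr2 : (2 : ℚ) ≤ r := by exact_mod_cast hr
  apply_fun (Nat.cast : ℕ → ℚ) at h1 h2 h3 h4 h6 h7
  push_cast [hr1] at h1 h2 h3 h4 h6 h7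
  rw [← hq] at h1 h2 h3 h4 h6
  have hr0 : (r : ℚ) ≠ 0 := by linarith
  have hrm : (r : ℚ) - 1 ≠ 0 := by linarith
  have hrp : (r : ℚ) + 1 ≠ 0 := by linarith
  have hA : (q - v) / (r - 1) = A := by
    rw [div_eq_iff hrm]; linear_combination -h4
  have hM : q / r = M := by
    rw [div_eq_iff hr0]; linear_combination -h6
  have hN3 : ((M : ℚ) - e) / (r - 1) = (r + 1) * N3 := by
    rw [div_eq_iff hrm]; linear_combination -h7
  rw [← div_div, hA, hM, hN3, mul_div_cancel_left₀ _ hrp]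
  refine ⟨rfl, ?_, ?_, ?_⟩
  · linear_combination h3 / 2
  · linear_combination h2 - h3
  · linear_combination h1 - h2 + h3 / 2

end RootCounts

/-! ### Additivity of the r-th power map, and the three parity cases. -/

lemma pow_add_of_isPrimePow {F : Type*} [Field F] [Finite F] {r d : ℕ} (hr : IsPrimePow r)
    (hd : 0 < d) (hF : Nat.card F = r ^ d) :
    (∀ x y : F, (x + y) ^ r = x ^ r + y ^ r) ∧ ∀ x y : F[X], (x + y) ^ r = x ^ r + y ^ r := by
  obtain ⟨p, k, hp, hk, rfl⟩ := hr
  have hp' : p.Prime := hp.nat_prime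
  have := Fact.mk hp'
  have := Fintype.ofFinite F
  have hchar : CharP F p := by
    obtain ⟨c, hc⟩ := CharP.exists F
    obtain ⟨n, hcp, hn⟩ := FiniteField.card F c
    rw [← Nat.card_eq_fintype_card, hF, ← pow_mul] at hn
    have hdvd : p ∣ c := hp'.dvd_of_dvd_pow (hn ▸ dvd_pow_self p (by positivity))
    rwa [(Nat.prime_dvd_prime_iff_eq hp' hcp).1 hdvd]
  exact ⟨fun x y => add_pow_char_pow x y p k, fun x y => add_pow_char_pow x y p k⟩

end ProjPoly

theorem mainTheorem7 {F : Type*} [Field F] [Finite F] (r d q : ℕ) (hr : IsPrimePow r)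
    (hd : 0 < d) (hq : q = r ^ d) (hF : Nat.card F = q) :
    (∀ i : ℕ, ProjPoly.C2 F r 2 i =
      {p : F × F | p.1 ≠ 0 ∧ p.2 ≠ 0 ∧ ProjPoly.HasMaximalCollision r
        (X ^ (r ^ 2) + C p.1 * X ^ r + C p.2 * X : F[X]) i}) ∧
    (∀ i : ℕ, i ∉ ({0, 1, 2, r + 1} : Set ℕ) → ProjPoly.C2 F r 2 i = ∅) ∧
    (Even d →
      (ProjPoly.c2 F r 2 0 : ℚ) = r * (q - 1) ^ 2 / (2 * (r + 1)) ∧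
      (ProjPoly.c2 F r 2 1 : ℚ) = q * (q - 1) / r ∧
      (ProjPoly.c2 F r 2 2 : ℚ) = (q - 1) ^ 2 * (r - 2) / (2 * (r - 1)) ∧
      (ProjPoly.c2 F r 2 (r + 1) : ℚ) = (q - 1) * (q - r ^ 2) / (r * (r ^ 2 - 1))) ∧
    (Odd r → Odd d →
      (ProjPoly.c2 F r 2 0 : ℚ) = (q * r - 1) * (q - 1) / (2 * (r + 1)) ∧
      (ProjPoly.c2 F r 2 1 : ℚ) = q * (q - 1) / r ∧
      (ProjPoly.c2 F r 2 2 : ℚ) =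
        (q - 1) * (q * r - 2 * q - 2 * r + 3) / (2 * (r - 1)) ∧
      (ProjPoly.c2 F r 2 (r + 1) : ℚ) = (q - r) * (q - 1) / (r * (r ^ 2 - 1))) ∧
    (Even r → Odd d →
      (ProjPoly.c2 F r 2 0 : ℚ) = r * (q ^ 2 - 1) / (2 * (r + 1)) ∧
      (ProjPoly.c2 F r 2 1 : ℚ) = (q - 1) * (q - r) / r ∧
      (ProjPoly.c2 F r 2 2 : ℚ) = (q - 1) ^ 2 * (r - 2) / (2 * (r - 1)) ∧
      (ProjPoly.c2 F r 2 (r + 1) : ℚ) = (q - r) * (q - 1) / (r * (r ^ 2 - 1))) ∧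
    (∀ i : ℕ, ProjPoly.c2 F r 2 i = (q - 1) * ProjPoly.bluherCount F r i) := by
  have hr2 : 2 ≤ r := hr.two_le
  have hF' : Nat.card F = r ^ d := hF.trans hq
  obtain ⟨hadd, haddX⟩ := ProjPoly.pow_add_of_isPrimePow (F := F) hr hd hF'
  have hc2 : ∀ i, ProjPoly.c2 F r 2 i = (q - 1) * ProjPoly.bluherCount F r i := fun i => by
    rw [ProjPoly.c2_eq_mul_bluherCount hr2, hF]
  have hq1 : ((q - 1 : ℕ) : ℚ) = q - 1 := by
    rw [Nat.cast_sub (hF ▸ Nat.card_pos), Nat.cast_one]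
  have hqF : (q : ℚ) = Nat.card F := by rw [hF]
  have hr2' : (2 : ℚ) ≤ r := by exact_mod_cast hr2
  have hr0 : (r : ℚ) ≠ 0 := by linarith
  have hrm : (r : ℚ) - 1 ≠ 0 := by linarith
  have hrp : (r : ℚ) + 1 ≠ 0 := by linarith
  have hrs : (r : ℚ) ^ 2 - 1 = (r - 1) * (r + 1) := by ring
  refine ⟨fun i => ?_, fun i hi => ?_, fun hde => ?_, fun hro hdo => ?_, fun hre hdo => ?_, hc2⟩
  · ext ⟨a, b⟩
    simp only [ProjPoly.C2, Set.mem_ofPred_eq, ProjPoly.hasMaximalCollision_iff hr2 hadd haddX,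
      mul_ne_zero_iff]
    tauto
  · have h := hc2 i
    rw [ProjPoly.bluherCount_eq_zero hr2 hadd hF' (by simpa using hi), mul_zero] at h
    exact (Set.ncard_eq_zero (Set.toFinite _)).1 h
  -- Here v = e = r.
  · obtain ⟨hv, hsub⟩ := ProjPoly.pow_eq_neg_of_even hr2 hadd hF' hde
    obtain ⟨h3, h2, h1, h0⟩ := ProjPoly.bluherCount_formula hr2 hadd hF' hv
      (by rw [Set.inter_eq_right.2 hsub, hv]) hqF
    simp only [hc2, Nat.cast_mul, hq1, h0, h1, h2, h3, hrs]
    refine ⟨?_, ?_, ?_, ?_⟩ <;> field_simp <;> ring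
  -- Here v = e = 1.
  · obtain ⟨h3, h2, h1, h0⟩ := ProjPoly.bluherCount_formula hr2 hadd hF'
      (ProjPoly.ncard_pow_eq_neg_of_odd hr2 hF' hro hdo)
      (ProjPoly.ncard_range_inter_of_odd hr2 hadd hF' hdo) hqF
    simp only [hc2, Nat.cast_mul, hq1, h0, h1, h2, h3, hrs]
    refine ⟨?_, ?_, ?_, ?_⟩ <;> field_simp <;> ring
  -- Here v = r, because -x = x, but e = 1.
  · obtain ⟨h3, h2, h1, h0⟩ := ProjPoly.bluherCount_formula hr2 hadd hF'
      (ProjPoly.ncard_pow_eq_neg_of_even hr2 hd hF' hre)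
      (ProjPoly.ncard_range_inter_of_odd hr2 hadd hF' hdo) hqF
    simp only [hc2, Nat.cast_mul, hq1, h0, h1, h2, h3, hrs]
    refine ⟨?_, ?_, ?_, ?_⟩ <;> field_simp <;> ring
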